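/- \textbf{Conventions.} Models are finite with at least two elements, over an arbitrary first-order vocabulary $L$. A team with domain a finite set $D$ of variables in a model $M$ is a set $T$ of assignments $s\colon D\to M$. \emph{Upper dimension.} A family $\mathcal D$ of sets is dominated if $\bigcup\mathcal D\in\mathcal D$, and convex if $S\subseteq C\subseteq T$ with $S,T\in\mathcal D$ implies $C\in\mathcal D$. A subfamily $\mathcal G\subseteq\mathcal A$ dominates $\mathcal A$ if there are dominated convex families $\mathcal D_G$ $(G\in\mathcal G)$ with $\bigcup\mathcal D_G=G$ and $\bigcup_{G\in\mathcal G}\mathcal D_G=\mathcal A$. The upper dimension of $\mathcal A$ is the least size of a subfamily dominating $\mathcal A$. \emph{Growth classes.} $\mathbb E_k$ is the set of $f\colon\mathbb N\to\mathbb N$ for which there is a polynomial $p$ of degree $k$ with coefficients in $\mathbb N$ such that $f(n)\le 2^{p(n)}$ for all $n$; $\mathbb F_k$ is the set of $f\colon\mathbb N\to\mathbb N$ for which there is such a $p$ with $f(n)\le n^{p(n)}$ for all $n\ge 2$. \emph{Logics.} A (general) atom of arity $r$ is given by an isomorphism-closed class $C$ of pairs $(A,T)$ with $T\subseteq A^r$;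 $M\models_T\alpha_C(\vec x)$ iff $(M,\{s(\vec x): s\in T\})\in C$. Its upper dimension function maps $n$ to the supremum of the upper dimensions of $\{T\subseteq A^r : (A,T)\in C\}$ over the sets $A$ with $|A|=n$ (with $|A|\ge 2$). The logic $\mathbb{LE}^U_k$ (respectively $\mathbb{LF}^U_k$) is the closure of the first-order literals (atomic and negated atomic formulas) and all atoms whose upper dimension function is in $\mathbb E_k$ (respectively $\mathbb F_k$) under $\wedge$, intuitionistic disjunction, tensor disjunction, tensor conjunction, and all Lindström quantifiers $Q_{\mathcal K}$, where $\mathcal K$ is an isomorphism-closed class of structures $(A,R)$, $R\subseteq A^r$, $r\ge1$. Team semantics: $T$ satisfies a literal iff every $s\in T$ does; $T$ satisfies $\varphi\wedge\psi$ (the intuitionistic disjunction of $\varphi$ and $\psi$) iff it satisfies both (at least one); $T$ satisfies the tensor disjunction (tensor conjunction) of $\varphi$ and $\psi$ iff $T=U\cup V$ ($T=U\cap V$) for teams $U,V$ with domain that of $T$ such that $M\models_U\varphi$ and $M\models_V\psi$; and $M\models_T Q_{\mathcal K}\vec y\,\psi$, with $\vec y$ a tuple of distinct variables, iff there is $F\colon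 T\to\mathcal P(M^r)$ with $(M,F(s))\in\mathcal K$ for all $s\in T$ and $M\models_{T[F/\vec y]}\psi$, where $T[F/\vec y]=\{s(\vec b/\vec y): s\in T,\ \vec b\in F(s)\}$. \emph{Particular atoms.} In a team $T$: inclusion $\vec x\subseteq\vec y$: for every $s\in T$ there is $s'\in T$ with $s(\vec x)=s'(\vec y)$; exclusion $\vec x\mid\vec y$: $s(\vec x)\ne s'(\vec y)$ for all $s,s'\in T$; anonymity $\vec x\mathrel\Upsilon y$: for every $s\in T$ there is $s'\in T$ with $s(\vec x)=s'(\vec x)$ and $s(y)\neq s'(y)$; dependence $=\!(\vec x,y)$: for all $s,s'\in T$, $s(\vec x)=s'(\vec x)$ implies $s(y)=s'(y)$; independence $\vec x\perp_{\vec z}\vec y$: for all $s,s'\in T$ with $s(\vec z)=s'(\vec z)$ there is $s''\in T$ with $s''(\vec z)=s(\vec z)$, $s''(\vec x)=s(\vec x)$, $s''(\vec y)=s'(\vec y)$. The variables displayed in an atom are pairwise distinct. The first four atoms are $k$-ary if $\vec x$ has length $k$ (and, for inclusion and exclusion, so has $\vec y$). The independence atom is $(k,l,m)$-ary if $\vec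 x,\vec y,\vec z$ have lengths $k\ge 1$, $l\ge 1$, $m\ge 0$. An atom with variables in a finite set $D$ is definable in a logic if, for some vocabulary, there is a formula of the logic with free variables in $D$ that is satisfied by exactly the same teams with domain $D$ as the atom, in all models (finite, with at least two elements) of that vocabulary. \textbf{Theorem.} Let $D$ be a finite set of variables containing the variables of the atom in question. (a) For every $k\ge 0$, the $(k+1)$-ary inclusion, anonymity and exclusion atoms are not definable in $\mathbb{LE}^U_k$. (b) For every $k\ge 0$, the $(k+1)$-ary dependence atom is not definable in $\mathbb{LF}^U_k$. (c) For all $k,l\ge 1$ and $m\ge 0$, the $(k,l,m)$-ary independence atom is not definable in $\mathbb{LF}^U_i$ for any $i<\max(k,l)+m$. -/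

import Mathlib

universe u v w

namespace TeamSem

/-! ### Upper dimension of a family of sets -/

/-- `𝒟` is dominated: its union belongs to it. -/
def IsDominated {X : Type*} (𝒟 : Set (Set X)) : Prop := ⋃₀ 𝒟 ∈ 𝒟

/-- `𝒟` is convex: `S, T ∈ 𝒟` and `S ⊆ C ⊆ T` imply `C ∈ 𝒟`. -/
def IsConvexFamily {X : Type*} (𝒟 : Set (Set X)) : Prop :=
  ∀ S ∈ 𝒟, ∀ T ∈ 𝒟, ∀ C : Set X, S ⊆ C → C ⊆ T → C ∈ 𝒟

/-- The subfamily `𝒢 ⊆ 𝒜` dominates `𝒜`: there are dominated convex families `𝒟 G`, for `G ∈ 𝒢`,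
with `⋃ (𝒟 G) = G`, whose union is `𝒜`. -/
def Dominates {X : Type*} (𝒢 𝒜 : Set (Set X)) : Prop :=
  𝒢 ⊆ 𝒜 ∧ ∃ 𝒟 : Set X → Set (Set X),
    (∀ G ∈ 𝒢, IsDominated (𝒟 G) ∧ IsConvexFamily (𝒟 G) ∧ ⋃₀ (𝒟 G) = G) ∧
    ⋃ G ∈ 𝒢, 𝒟 G = 𝒜

/-- The upper dimension: the least size of a subfamily that dominates `𝒜`. -/
noncomputable def upperDim {X : Type*} (𝒜 : Set (Set X)) : ℕ∞ :=
  ⨅ (𝒢 : Set (Set X)) (_ : Dominates 𝒢 𝒜), 𝒢.encard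

/-! ### Growth classes -/

/-- `𝔼_k`: functions bounded by `2 ^ p(n)`, `p` a polynomial of degree `k` over `ℕ`. -/
def growthE (k : ℕ) : Set (ℕ → ℕ) :=
  {f | ∃ p : Polynomial ℕ, p.natDegree = k ∧ ∀ n, f n ≤ 2 ^ p.eval n}

/-- `𝔽_k`: functions bounded by `n ^ p(n)` for `n ≥ 2`, `p` a polynomial of degree `k` over `ℕ`. -/
def growthF (k : ℕ) : Set (ℕ → ℕ) :=
  {f | ∃ p : Polynomial ℕ, p.natDegree = k ∧ ∀ n, 2 ≤ n → f n ≤ n ^ p.eval n}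

/-! ### Atoms and Lindström quantifiers -/

/-- A general atom: an isomorphism closed class of pairs `(A, T)`, where `T` is a team in `A` on
`arity` variables, i.e. a set of `arity`-tuples. -/
structure Atom : Type (u + 1) where
  arity : ℕ
  mem : (A : Type u) → Set (Fin arity → A) → Prop
  iso : ∀ (A B : Type u) (e : A ≃ B) (T : Set (Fin arity → A)),
    mem A T → mem B ((fun t => e ∘ t) '' T)

/-- The upper dimension function of an atom, relative to the tuple of its own variables. As always
in this development, the models are finite with at least two elements. -/
noncomputable def Atom.dim (α : Atom.{u}) (n : ℕ) : ℕ∞ :=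
  ⨆ (A : Type u) (_ : Finite A) (_ : Nontrivial A) (_ : Nat.card A = n),
    upperDim {T : Set (Fin α.arity → A) | α.mem A T}

/-- The upper dimension function of `α` is finite-valued and belongs to the class `𝕆`. -/
def Atom.DimIn (α : Atom.{u}) (𝕆 : Set (ℕ → ℕ)) : Prop :=
  ∃ f ∈ 𝕆, ∀ n, α.dim n = (f n : ℕ∞)

/-- A Lindström quantifier of type `(r)`, `r ≥ 1`: an isomorphism closed class of structures
`(A, R)` with `R ⊆ A ^ r`. -/
structure LindstromQuantifier : Type (u + 1) where
  r : ℕ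
  r_pos : 0 < r
  mem : (A : Type u) → Set (Fin r → A) → Prop
  iso : ∀ (A B : Type u) (e : A ≃ B) (R : Set (Fin r → A)),
    mem A R → mem B ((fun t => e ∘ t) '' R)

/-! ### Formulas and team semantics -/

/-- Formulas over the vocabulary `L` with free variables in the finite set `D` of variables (named
by natural numbers): first-order literals, arbitrary atoms, the four binary connectives, and
arbitrary Lindström quantifiers. A quantifier binds a tuple `y` of distinct variables, which may or
may not already be in `D`. -/
inductive Formula (L : FirstOrder.Language.{v, w}) : Finset ℕ → Type (max (u + 1) v w)
  | eq {D : Finset ℕ} (t₁ t₂ : L.Term D) : Formula L D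
  | neq {D : Finset ℕ} (t₁ t₂ : L.Term D) : Formula L D
  | rel {D : Finset ℕ} {n : ℕ} (R : L.Relations n) (t : Fin n → L.Term D) : Formula L D
  | nrel {D : Finset ℕ} {n : ℕ} (R : L.Relations n) (t : Fin n → L.Term D) : Formula L D
  | atom {D : Finset ℕ} (α : Atom.{u}) (x : Fin α.arity → D) : Formula L D
  | conj {D : Finset ℕ} (φ ψ : Formula L D) : Formula L D
  | tensorDisj {D : Finset ℕ} (φ ψ : Formula L D) : Formula L D
  | tensorConj {D : Finset ℕ} (φ ψ : Formula L D) : Formula L D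
  | intDisj {D : Finset ℕ} (φ ψ : Formula L D) : Formula L D
  | quant {D : Finset ℕ} (Q : LindstromQuantifier.{u}) (y : Fin Q.r ↪ ℕ)
      (φ : Formula L (D ∪ Finset.univ.map y)) : Formula L D

/-- The assignment `s(b/y)`, with domain `D ∪ {y₀, …, y_{r-1}}`. -/
noncomputable def update {M : Type u} {D : Finset ℕ} {r : ℕ} (s : D → M) (y : Fin r ↪ ℕ)
    (b : Fin r → M) : ↥(D ∪ Finset.univ.map y) → M := by
  classical
  exact fun v =>
    if h : ∃ i, y i = v.1 then b h.choose
    else s ⟨v.1, (Finset.mem_union.1 v.2).resolve_right (by simpa using h)⟩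

/-- The team `T[F/y] = {s(b/y) ∣ s ∈ T, b ∈ F(s)}`. -/
def supplement {M : Type u} {D : Finset ℕ} {r : ℕ} (T : Set (D → M))
    (F : (D → M) → Set (Fin r → M)) (y : Fin r ↪ ℕ) :
    Set (↥(D ∪ Finset.univ.map y) → M) :=
  {s' | ∃ s ∈ T, ∃ b ∈ F s, s' = update s y b}

/-- Satisfaction `M ⊨_T φ` of a formula by a team `T` with domain `D`. -/
def Sat {L : FirstOrder.Language.{v, w}} (M : Type u) [L.Structure M] :
    {D : Finset ℕ} → Formula.{u} L D → Set (D → M) → Prop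
  | _, .eq t₁ t₂, T => ∀ s ∈ T, t₁.realize s = t₂.realize s
  | _, .neq t₁ t₂, T => ∀ s ∈ T, t₁.realize s ≠ t₂.realize s
  | _, .rel R t, T => ∀ s ∈ T, FirstOrder.Language.Structure.RelMap R fun i => (t i).realize s
  | _, .nrel R t, T => ∀ s ∈ T, ¬ FirstOrder.Language.Structure.RelMap R fun i => (t i).realize s
  | _, .atom α x, T => α.mem M ((fun s => s ∘ x) '' T)
  | _, .conj φ ψ, T => Sat M φ T ∧ Sat M ψ T
  | _, .tensorDisj φ ψ, T => ∃ U V, T = U ∪ V ∧ Sat M φ U ∧ Sat M ψ V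
  | _, .tensorConj φ ψ, T => ∃ U V, T = U ∩ V ∧ Sat M φ U ∧ Sat M ψ V
  | _, .intDisj φ ψ, T => Sat M φ T ∨ Sat M ψ T
  | D, .quant Q y φ, T => ∃ F : (D → M) → Set (Fin Q.r → M),
      Sat M φ (supplement T F y) ∧ ∀ s ∈ T, Q.mem M (F s)

/-- Every general atom occurring in the formula has the property `P`. -/
def Formula.AtomsSatisfy {L : FirstOrder.Language.{v, w}} (P : Atom.{u} → Prop) :
    {D : Finset ℕ} → Formula.{u} L D → Prop
  | _, .eq _ _ => True
  | _, .neq _ _ => True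
  | _, .rel _ _ => True
  | _, .nrel _ _ => True
  | _, .atom α _ => P α
  | _, .conj φ ψ => φ.AtomsSatisfy P ∧ ψ.AtomsSatisfy P
  | _, .tensorDisj φ ψ => φ.AtomsSatisfy P ∧ ψ.AtomsSatisfy P
  | _, .tensorConj φ ψ => φ.AtomsSatisfy P ∧ ψ.AtomsSatisfy P
  | _, .intDisj φ ψ => φ.AtomsSatisfy P ∧ ψ.AtomsSatisfy P
  | _, .quant _ _ φ => φ.AtomsSatisfy P

/-- The formulas of the logic `𝕃𝔼^U_k` in the vocabulary `L` with free variables in `D`. -/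
def LEU (L : FirstOrder.Language.{v, w}) (k : ℕ) (D : Finset ℕ) : Set (Formula.{u} L D) :=
  {φ | φ.AtomsSatisfy fun α => α.DimIn (growthE k)}

/-- The formulas of the logic `𝕃𝔽^U_k` in the vocabulary `L` with free variables in `D`. -/
def LFU (L : FirstOrder.Language.{v, w}) (k : ℕ) (D : Finset ℕ) : Set (Formula.{u} L D) :=
  {φ | φ.AtomsSatisfy fun α => α.DimIn (growthF k)}

/-- The property `P` of teams with domain `D` is definable by a formula in the set `Φ`, over the
finite models with at least two elements. -/
def Definable {L : FirstOrder.Language.{v, w}} {D : Finset ℕ} (Φ : Set (Formula.{u} L D))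
    (P : (M : Type u) → Set (D → M) → Prop) : Prop :=
  ∃ φ ∈ Φ, ∀ (M : Type u) [L.Structure M] [Finite M] [Nontrivial M] (T : Set (D → M)),
    Sat M φ T ↔ P M T

/-! ### The particular atoms -/

/-- The inclusion atom `x ⊆ y`. -/
def inclusionAtom {D : Finset ℕ} {k : ℕ} (x y : Fin k → D) (M : Type u) (T : Set (D → M)) : Prop :=
  ∀ s ∈ T, ∃ s' ∈ T, s ∘ x = s' ∘ y

/-- The anonymity atom `x Υ y`. -/
def anonymityAtom {D : Finset ℕ} {k : ℕ} (x : Fin k → D) (y : D) (M : Type u)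
    (T : Set (D → M)) : Prop :=
  ∀ s ∈ T, ∃ s' ∈ T, s ∘ x = s' ∘ x ∧ s y ≠ s' y

/-- The exclusion atom `x | y`. -/
def exclusionAtom {D : Finset ℕ} {k : ℕ} (x y : Fin k → D) (M : Type u) (T : Set (D → M)) : Prop :=
  ∀ s ∈ T, ∀ s' ∈ T, s ∘ x ≠ s' ∘ y

/-- The dependence atom `=(x, y)`. -/
def dependenceAtom {D : Finset ℕ} {k : ℕ} (x : Fin k → D) (y : D) (M : Type u)
    (T : Set (D → M)) : Prop :=
  ∀ s ∈ T, ∀ s' ∈ T, s ∘ x = s' ∘ x → s y = s' y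

/-- The independence atom `x ⊥_z y`. -/
def independenceAtom {D : Finset ℕ} {k l m : ℕ} (x : Fin k → D) (y : Fin l → D) (z : Fin m → D)
    (M : Type u) (T : Set (D → M)) : Prop :=
  ∀ s ∈ T, ∀ s' ∈ T, s ∘ z = s' ∘ z →
    ∃ s'' ∈ T, s'' ∘ z = s ∘ z ∧ s'' ∘ x = s ∘ x ∧ s'' ∘ y = s' ∘ y

/-- The tuples `x` and `y` consist of pairwise distinct variables, without common ones. -/
def Distinct₂ {D : Finset ℕ} {k l : ℕ} (x : Fin k → D) (y : Fin l → D) : Prop :=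
  Function.Injective (Sum.elim x y)

/-- The tuples `x`, `y`, `z` consist of pairwise distinct variables, without common ones. -/
def Distinct₃ {D : Finset ℕ} {k l m : ℕ} (x : Fin k → D) (y : Fin l → D) (z : Fin m → D) : Prop :=
  Function.Injective (Sum.elim x (Sum.elim y z))

end TeamSem

/-! Upper dimension is estimated from above for all formulas and from below for the atoms. A
dominated convex family is a family closed upwards below its own union; allowing the empty one gives
cells. Every connective and every Lindström quantifier, applied to single cells, yields a cell
again. So an operation with two arguments at worst multiplies the numbers of cells, and
intuitionistic disjunction adds them. By induction (`Formula.growthBound`) a formula of `LFU L i D`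
defines, in a model of size `n`, a union of at most `n ^ q(n)` cells with `q` of degree at most `i`.

Each particular atom, in turn, admits teams `T A`, indexed by the subsets `A` of a set of at least
`n ^ K / 2` elements, no two of which can share a cell (`IsFooling`). It therefore needs at least `2
^ (n ^ K / 2)` cells, more than `n ^ q(n)` for a suitable `n` as soon as `i < K`. As `growthE k ⊆
growthF k`, part (a) follows from the stronger statement for `LFU`. -/

namespace TeamSem

/-! ### Cells and covers -/

/-- A cell is a family of sets that is empty, or dominated and convex. -/
def IsCell {X : Type*} (𝒟 : Set (Set X)) : Prop :=
  ∀ S ∈ 𝒟, ∀ C : Set X, S ⊆ C → C ⊆ ⋃₀ 𝒟 → C ∈ 𝒟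

/-- `𝒜` is a union of at most `n` cells. -/
def HasCover {X : Type*} (𝒜 : Set (Set X)) (n : ℕ) : Prop :=
  ∃ 𝒞 : Finset (Set (Set X)), 𝒞.card ≤ n ∧ (∀ 𝒟 ∈ 𝒞, IsCell 𝒟) ∧ ∀ T, T ∈ 𝒜 ↔ ∃ 𝒟 ∈ 𝒞, T ∈ 𝒟

theorem HasCover.mono {X : Type*} {𝒜 : Set (Set X)} {n m : ℕ} (h : HasCover 𝒜 n) (hnm : n ≤ m) :
    HasCover 𝒜 m := by
  obtain ⟨𝒞, h₁, h₂⟩ := h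
  exact ⟨𝒞, h₁.trans hnm, h₂⟩

theorem IsCell.hasCover {X : Type*} {𝒜 : Set (Set X)} (h : IsCell 𝒜) : HasCover 𝒜 1 :=
  ⟨{𝒜}, by simp, by simpa using h, by simp⟩

/-- The families of an optimal dominating subfamily are cells: convexity is applied between a member
and the union, itself a member by domination. -/
theorem hasCover_of_upperDim_le {X : Type*} {𝒜 : Set (Set X)} {n : ℕ} (h : upperDim 𝒜 ≤ n) :
    HasCover 𝒜 n := by
  classical
  have h' : upperDim 𝒜 < ((n + 1 : ℕ) : ℕ∞) := h.trans_lt (by exact_mod_cast Nat.lt_succ_self n)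
  simp only [upperDim, iInf_lt_iff] at h'
  obtain ⟨𝒢, ⟨-, 𝒟, h𝒟, hU⟩, hlt⟩ := h'
  have hfin : 𝒢.Finite := Set.finite_of_encard_le_coe hlt.le
  refine ⟨hfin.toFinset.image 𝒟, Finset.card_image_le.trans ?_, ?_, fun T => ?_⟩
  · rw [hfin.encard_eq_coe_toFinset_card] at hlt
    exact Nat.lt_succ_iff.1 (by exact_mod_cast hlt)
  · intro ℰ hℰ
    simp only [Finset.mem_image, Set.Finite.mem_toFinset] at hℰ
    obtain ⟨G, hG, rfl⟩ := hℰ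
    exact fun S hS C hSC hC => (h𝒟 G hG).2.1 S hS _ (h𝒟 G hG).1 C hSC hC
  · rw [← hU]
    simp

theorem HasCover.union {X : Type*} {𝒜 ℬ : Set (Set X)} {a b : ℕ} (hA : HasCover 𝒜 a)
    (hB : HasCover ℬ b) : HasCover {T | T ∈ 𝒜 ∨ T ∈ ℬ} (a + b) := by
  classical
  obtain ⟨𝒞, hC, hC', hA⟩ := hA
  obtain ⟨ℰ, hE, hE', hB⟩ := hB
  refine ⟨𝒞 ∪ ℰ, (Finset.card_union_le _ _).trans (add_le_add hC hE), ?_, fun T => ?_⟩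
  · intro 𝒟 h
    exact (Finset.mem_union.1 h).elim (hC' 𝒟) (hE' 𝒟)
  · simp only [Set.mem_ofPred_eq, hA, hB, Finset.mem_union, or_and_right, exists_or]

theorem HasCover.map {X Y : Type*} {𝒜 : Set (Set X)} {a : ℕ} (R : Set Y → Set X → Prop)
    (hR : ∀ 𝒟, IsCell 𝒟 → IsCell {T | ∃ U ∈ 𝒟, R T U}) (hA : HasCover 𝒜 a) :
    HasCover {T | ∃ U ∈ 𝒜, R T U} a := by
  classical
  obtain ⟨𝒞, hC, hC', hA⟩ := hA
  refine ⟨𝒞.image fun 𝒟 => {T | ∃ U ∈ 𝒟, R T U}, Finset.card_image_le.trans hC, ?_, fun T => ?_⟩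
  · simp only [Finset.mem_image]
    rintro _ ⟨𝒟, h, rfl⟩
    exact hR 𝒟 (hC' 𝒟 h)
  · simp only [Set.mem_ofPred_eq, hA, Finset.mem_image]
    constructor
    · rintro ⟨U, ⟨𝒟, h, hU⟩, hT⟩
      exact ⟨_, ⟨𝒟, h, rfl⟩, U, hU, hT⟩
    · rintro ⟨_, ⟨𝒟, h, rfl⟩, U, hU, hT⟩
      exact ⟨U, ⟨𝒟, h, hU⟩, hT⟩

/-- Existential quantification distributes over unions, so a binary operation has only to be checked
on pairs of cells. -/
theorem HasCover.map₂ {X Y Z : Type*} {𝒜 : Set (Set X)} {ℬ : Set (Set Y)} {a b : ℕ}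
    (R : Set Z → Set X → Set Y → Prop)
    (hR : ∀ 𝒟 ℰ, IsCell 𝒟 → IsCell ℰ → IsCell {T | ∃ U ∈ 𝒟, ∃ V ∈ ℰ, R T U V})
    (hA : HasCover 𝒜 a) (hB : HasCover ℬ b) :
    HasCover {T | ∃ U ∈ 𝒜, ∃ V ∈ ℬ, R T U V} (a * b) := by
  classical
  obtain ⟨𝒞, hC, hC', hA⟩ := hA
  obtain ⟨𝒞', hE, hE', hB⟩ := hB
  refine ⟨Finset.image₂ (fun 𝒟 ℰ => {T | ∃ U ∈ 𝒟, ∃ V ∈ ℰ, R T U V}) 𝒞 𝒞',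
    (Finset.card_image₂_le _ _ _).trans (Nat.mul_le_mul hC hE), ?_, fun T => ?_⟩
  · simp only [Finset.mem_image₂]
    rintro _ ⟨𝒟, h, ℰ, h', rfl⟩
    exact hR 𝒟 ℰ (hC' 𝒟 h) (hE' ℰ h')
  · simp only [Set.mem_ofPred_eq, hA, hB, Finset.mem_image₂]
    constructor
    · rintro ⟨U, ⟨𝒟, h, hU⟩, V, ⟨ℰ, h', hV⟩, hT⟩
      exact ⟨_, ⟨𝒟, h, ℰ, h', rfl⟩, U, hU, V, hV, hT⟩
    · rintro ⟨_, ⟨𝒟, h, ℰ, h', rfl⟩, U, hU, V, hV, hT⟩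
      exact ⟨U, ⟨𝒟, h, hU⟩, V, ⟨ℰ, h', hV⟩, hT⟩

/-! ### Operations that preserve cells -/

theorem isCell_flat {X : Type*} (p : X → Prop) : IsCell {T : Set X | ∀ s ∈ T, p s} := by
  intro S _ C _ hC s hs
  obtain ⟨T, hT, hsT⟩ := hC hs
  exact hT s hsT

theorem IsCell.inter {X : Type*} {𝒟 ℰ : Set (Set X)} (h : IsCell 𝒟) (h' : IsCell ℰ) :
    IsCell {T | ∃ U ∈ 𝒟, ∃ V ∈ ℰ, T = U ∧ T = V} := by
  rintro S ⟨_, hU, _, hV, rfl, rfl⟩ C hSC hC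
  refine ⟨C, h S hU C hSC fun s hs => ?_, C, h' S hV C hSC fun s hs => ?_, rfl, rfl⟩
  · obtain ⟨T, ⟨_, hT, _, -, rfl, -⟩, hs⟩ := hC hs
    exact ⟨T, hT, hs⟩
  · obtain ⟨T, ⟨_, -, _, hT, -, rfl⟩, hs⟩ := hC hs
    exact ⟨T, hT, hs⟩

theorem IsCell.tensorDisj {X : Type*} {𝒟 ℰ : Set (Set X)} (h : IsCell 𝒟) (h' : IsCell ℰ) :
    IsCell {T | ∃ U ∈ 𝒟, ∃ V ∈ ℰ, T = U ∪ V} := by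
  rintro S ⟨U, hU, V, hV, rfl⟩ C hSC hC
  have hC' : C ⊆ ⋃₀ 𝒟 ∪ ⋃₀ ℰ := by
    intro s hs
    obtain ⟨_, ⟨U', hU', V', hV', rfl⟩, hs | hs⟩ := hC hs
    · exact Or.inl ⟨U', hU', hs⟩
    · exact Or.inr ⟨V', hV', hs⟩
  -- The largest possible parts of `C` are used; they contain `U` and `V`.
  refine ⟨C ∩ ⋃₀ 𝒟, h U hU _ ?_ Set.inter_subset_right,
    C ∩ ⋃₀ ℰ, h' V hV _ ?_ Set.inter_subset_right, ?_⟩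
  · exact fun s hs => ⟨hSC (Or.inl hs), U, hU, hs⟩
  · exact fun s hs => ⟨hSC (Or.inr hs), V, hV, hs⟩
  · rw [← Set.inter_union_distrib_left, Set.inter_eq_left.2 hC']

theorem IsCell.tensorConj {X : Type*} {𝒟 ℰ : Set (Set X)} (h : IsCell 𝒟) (h' : IsCell ℰ) :
    IsCell {T | ∃ U ∈ 𝒟, ∃ V ∈ ℰ, T = U ∩ V} := by
  rintro S ⟨U, hU, V, hV, rfl⟩ C hSC hC
  -- Distributivity gives `(C ∪ U) ∩ (C ∪ V) = C ∪ (U ∩ V) = C`.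
  refine ⟨C ∪ U, h U hU _ Set.subset_union_right ?_,
    C ∪ V, h' V hV _ Set.subset_union_right ?_, ?_⟩
  · rintro s (hs | hs)
    · obtain ⟨_, ⟨U', hU', V', hV', rfl⟩, hs⟩ := hC hs
      exact ⟨U', hU', hs.1⟩
    · exact ⟨U, hU, hs⟩
  · rintro s (hs | hs)
    · obtain ⟨_, ⟨U', hU', V', hV', rfl⟩, hs⟩ := hC hs
      exact ⟨V', hV', hs.2⟩
    · exact ⟨V, hV, hs⟩
  · rw [← Set.union_inter_distrib_left, Set.union_eq_left.2 hSC]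

theorem IsCell.preimage_image {X Y : Type*} (g : Y → X) {𝒟 : Set (Set X)} (h : IsCell 𝒟) :
    IsCell {T | ∃ U ∈ 𝒟, g '' T = U} := by
  rintro S ⟨_, hU, rfl⟩ C hSC hC
  refine ⟨g '' C, h _ hU _ (Set.image_mono hSC) ?_, rfl⟩
  rintro _ ⟨s, hs, rfl⟩
  obtain ⟨T, ⟨_, hT, rfl⟩, hs⟩ := hC hs
  exact ⟨_, hT, Set.mem_image_of_mem g hs⟩

/-- The condition on `F` is local to each assignment, so choice functions of different teams can be
glued: the one for `S` is kept on `S`, and any other `s ∈ C` takes its value from some team of the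
family containing `s`. The supplemented team then lies between a member of `𝒟` and `⋃₀ 𝒟`. -/
theorem IsCell.quant {M : Type u} {D : Finset ℕ} {r : ℕ} (y : Fin r ↪ ℕ)
    (K : Set (Fin r → M) → Prop) {𝒟 : Set (Set (↥(D ∪ Finset.univ.map y) → M))} (h : IsCell 𝒟) :
    IsCell {T | ∃ U ∈ 𝒟, ∃ F : (D → M) → Set (Fin r → M),
      supplement T F y = U ∧ ∀ s ∈ T, K (F s)} := by
  classical
  rintro S ⟨_, hU, F₀, rfl, hF₀⟩ C hSC hC
  have key : ∀ s, ∃ B, s ∈ C → K B ∧ ∀ b ∈ B, update s y b ∈ ⋃₀ 𝒟 := by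
    intro s
    by_cases hs : s ∈ C
    · obtain ⟨T, ⟨_, hT, F, rfl, hF⟩, hsT⟩ := hC hs
      exact ⟨F s, fun _ => ⟨hF s hsT, fun b hb => ⟨_, hT, s, hsT, b, hb, rfl⟩⟩⟩
    · exact ⟨∅, fun h => absurd h hs⟩
  choose F₁ hF₁ using key
  refine ⟨_, h _ hU (supplement C (fun s => if s ∈ S then F₀ s else F₁ s) y) ?_ ?_, _, rfl, ?_⟩
  · rintro _ ⟨s, hs, b, hb, rfl⟩
    exact ⟨s, hSC hs, b, by simpa [hs] using hb, rfl⟩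
  · rintro _ ⟨s, hs, b, hb, rfl⟩
    by_cases hS : s ∈ S
    · simp only [hS, if_true] at hb
      exact ⟨_, hU, s, hS, b, hb, rfl⟩
    · simp only [hS, if_false] at hb
      exact (hF₁ s hs).2 b hb
  · intro s hs
    by_cases hS : s ∈ S
    · simpa [hS] using hF₀ s hS
    · simpa [hS] using (hF₁ s hs).1

/-! ### The growth of the upper dimension of a formula -/

theorem pow_add_pow_le {n : ℕ} (hn : 2 ≤ n) (a b : ℕ) : n ^ a + n ^ b ≤ n ^ (a + b + 1) := by
  have h₁ : n ^ a ≤ n ^ (a + b) := Nat.pow_le_pow_right (by omega) (by omega)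
  have h₂ : n ^ b ≤ n ^ (a + b) := Nat.pow_le_pow_right (by omega) (by omega)
  calc n ^ a + n ^ b ≤ n ^ (a + b) * 2 := by omega
    _ ≤ n ^ (a + b) * n := Nat.mul_le_mul_left _ hn
    _ = n ^ (a + b + 1) := (pow_succ _ _).symm

/-- The upper dimension of `φ` is bounded by `n ^ q(n)`, with `q` of degree at most `i`. -/
def Formula.GrowthBound {L : FirstOrder.Language.{v, w}} (i : ℕ) {D : Finset ℕ}
    (φ : Formula.{u} L D) : Prop :=
  ∃ q : Polynomial ℕ, q.natDegree ≤ i ∧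
    ∀ (M : Type u) [L.Structure M] [Finite M] [Nontrivial M],
      HasCover {T : Set (D → M) | Sat M φ T} (Nat.card M ^ q.eval (Nat.card M))

theorem Formula.GrowthBound.of_isCell {L : FirstOrder.Language.{v, w}} {i : ℕ} {D : Finset ℕ}
    {φ : Formula.{u} L D}
    (h : ∀ (M : Type u) [L.Structure M], IsCell {T : Set (D → M) | Sat M φ T}) :
    φ.GrowthBound i :=
  ⟨0, by simp, fun M _ _ _ => by simpa using (h M).hasCover⟩

theorem Formula.GrowthBound.map₂ {L : FirstOrder.Language.{v, w}} {i : ℕ} {D : Finset ℕ}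
    {φ ψ χ : Formula.{u} L D} (hφ : φ.GrowthBound i) (hψ : ψ.GrowthBound i)
    (R : ∀ {M : Type u}, Set (D → M) → Set (D → M) → Set (D → M) → Prop)
    (hR : ∀ {M : Type u} (𝒟 ℰ : Set (Set (D → M))), IsCell 𝒟 → IsCell ℰ →
      IsCell {T | ∃ U ∈ 𝒟, ∃ V ∈ ℰ, R T U V})
    (hχ : ∀ (M : Type u) [L.Structure M] (T : Set (D → M)), Sat M χ T ↔
      ∃ U, Sat M φ U ∧ ∃ V, Sat M ψ V ∧ R T U V) :
    χ.GrowthBound i := by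
  obtain ⟨p, hp, hp'⟩ := hφ
  obtain ⟨q, hq, hq'⟩ := hψ
  refine ⟨p + q, (Polynomial.natDegree_add_le _ _).trans (max_le hp hq), fun M _ _ _ => ?_⟩
  have := HasCover.map₂ R hR (hp' M) (hq' M)
  rw [Polynomial.eval_add, pow_add]
  simpa only [hχ, Set.mem_ofPred_eq] using this

theorem Formula.growthBound {L : FirstOrder.Language.{v, w}} {i : ℕ} {D : Finset ℕ}
    (φ : Formula.{u} L D) (hφ : φ.AtomsSatisfy fun α => α.DimIn (growthF i)) :
    φ.GrowthBound i := by
  induction φ with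
  | eq t₁ t₂ => exact .of_isCell fun M _ => by simpa only [Sat] using isCell_flat _
  | neq t₁ t₂ => exact .of_isCell fun M _ => by simpa only [Sat] using isCell_flat _
  | rel R t => exact .of_isCell fun M _ => by simpa only [Sat] using isCell_flat _
  | nrel R t => exact .of_isCell fun M _ => by simpa only [Sat] using isCell_flat _
  | atom α x =>
    obtain ⟨f, ⟨p, hp, hf⟩, hdim⟩ := hφ
    refine ⟨p, hp.le, fun M _ _ _ => ?_⟩
    have hle : upperDim {T : Set (Fin α.arity → M) | α.mem M T} ≤ (f (Nat.card M) : ℕ∞) := by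
      rw [← hdim, Atom.dim]
      exact le_iSup_of_le M (le_iSup_of_le ‹_› (le_iSup_of_le ‹_› (le_iSup_of_le rfl le_rfl)))
    have := ((hasCover_of_upperDim_le hle).mono (hf _ Finite.one_lt_card)).map
      _ (fun 𝒟 => IsCell.preimage_image (fun s : _ → M => s ∘ x))
    simpa only [Sat, Set.mem_ofPred_eq, exists_eq_right'] using this
  | conj φ ψ ihφ ihψ =>
    exact (ihφ hφ.1).map₂ (ihψ hφ.2) (fun T U V => T = U ∧ T = V) (fun _ _ => IsCell.inter)
      fun M _ T => ⟨fun h => ⟨T, h.1, T, h.2, rfl, rfl⟩,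
        by rintro ⟨_, h, _, h', rfl, rfl⟩; exact ⟨h, h'⟩⟩
  | tensorDisj φ ψ ihφ ihψ =>
    exact (ihφ hφ.1).map₂ (ihψ hφ.2) (fun T U V => T = U ∪ V) (fun _ _ => IsCell.tensorDisj)
      fun M _ T => ⟨fun ⟨U, V, h, hU, hV⟩ => ⟨U, hU, V, hV, h⟩,
        fun ⟨U, hU, V, hV, h⟩ => ⟨U, V, h, hU, hV⟩⟩
  | tensorConj φ ψ ihφ ihψ =>
    exact (ihφ hφ.1).map₂ (ihψ hφ.2) (fun T U V => T = U ∩ V) (fun _ _ => IsCell.tensorConj)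
      fun M _ T => ⟨fun ⟨U, V, h, hU, hV⟩ => ⟨U, hU, V, hV, h⟩,
        fun ⟨U, hU, V, hV, h⟩ => ⟨U, V, h, hU, hV⟩⟩
  | intDisj φ ψ ihφ ihψ =>
    obtain ⟨p, hp, hp'⟩ := ihφ hφ.1
    obtain ⟨q, hq, hq'⟩ := ihψ hφ.2
    refine ⟨p + q + 1, ?_, fun M _ _ _ => ?_⟩
    · exact (Polynomial.natDegree_add_le _ _).trans
        (max_le ((Polynomial.natDegree_add_le _ _).trans (max_le hp hq)) (by simp))
    · have := ((hp' M).union (hq' M)).mono (pow_add_pow_le Finite.one_lt_card _ _)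
      simpa only [Sat, Set.mem_ofPred_eq, Polynomial.eval_add, Polynomial.eval_one] using this
  | quant Q y φ ih =>
    obtain ⟨p, hp, hp'⟩ := ih hφ
    refine ⟨p, hp, fun M _ _ _ => ?_⟩
    have := (hp' M).map _ (fun 𝒟 => IsCell.quant y (Q.mem M))
    refine (congrArg (HasCover · _) (Set.ext fun T => ?_)).mp this
    constructor
    · rintro ⟨_, hU, F, rfl, hF⟩
      exact ⟨F, hU, hF⟩
    · rintro ⟨F, hU, hF⟩
      exact ⟨_, hU, F, rfl, hF⟩

theorem growthE_subset_growthF (k : ℕ) : growthE k ⊆ growthF k := fun _ ⟨p, hp, h⟩ =>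
  ⟨p, hp, fun n hn => (h n).trans (Nat.pow_le_pow_left hn _)⟩

theorem Formula.AtomsSatisfy.mono {L : FirstOrder.Language.{v, w}} {P P' : Atom.{u} → Prop}
    (hP : ∀ α, P α → P' α) {D : Finset ℕ} {φ : Formula.{u} L D} (h : φ.AtomsSatisfy P) :
    φ.AtomsSatisfy P' := by
  induction φ with
  | eq | neq | rel | nrel => trivial
  | atom α x => exact hP α h
  | conj φ ψ ihφ ihψ => exact ⟨ihφ h.1, ihψ h.2⟩
  | tensorDisj φ ψ ihφ ihψ => exact ⟨ihφ h.1, ihψ h.2⟩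
  | tensorConj φ ψ ihφ ihψ => exact ⟨ihφ h.1, ihψ h.2⟩
  | intDisj φ ψ ihφ ihψ => exact ⟨ihφ h.1, ihψ h.2⟩
  | quant Q y φ ih => exact ih h

theorem LEU_subset_LFU (L : FirstOrder.Language.{v, w}) (k : ℕ) (D : Finset ℕ) :
    LEU.{u} L k D ⊆ LFU.{u} L k D := fun _ h =>
  Formula.AtomsSatisfy.mono (fun _ ⟨f, hf, hα⟩ => ⟨f, growthE_subset_growthF k hf, hα⟩) h

/-! ### Lower bounds -/

/-- The sets `T X` belong to `𝒜`, but no two of them belong to the same dominated convex subfamily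
of `𝒜`. -/
def IsFooling {W X : Type*} (𝒜 : Set (Set X)) (T : Set W → Set X) : Prop :=
  (∀ A, T A ∈ 𝒜) ∧ ∀ A B, ∀ c ∈ B, c ∉ A → ∃ C, T A ⊆ C ∧ C ⊆ T A ∪ T B ∧ C ∉ 𝒜

/-- Choosing for each `A` a cell containing `T A` is injective: a cell shared by `T A` and `T B`
contains everything between `T A` and `T A ∪ T B`, which forces `B ⊆ A`, and symmetrically. -/
theorem IsFooling.two_pow_le {W X : Type*} [Finite W] {𝒜 : Set (Set X)} {T : Set W → Set X}
    (h : IsFooling 𝒜 T) {n : ℕ} (hn : HasCover 𝒜 n) : 2 ^ Nat.card W ≤ n := by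
  obtain ⟨𝒞, hcard, hcell, h𝒜⟩ := hn
  choose c hc hT using fun A => (h𝒜 (T A)).1 (h.1 A)
  have hsub : ∀ A B, c A = c B → B ⊆ A := by
    intro A B hAB x hx
    by_contra hxA
    obtain ⟨C, h₁, h₂, h₃⟩ := h.2 A B x hx hxA
    refine h₃ ((h𝒜 C).2 ⟨c A, hc A, hcell _ (hc A) _ (hT A) C h₁ (h₂.trans ?_)⟩)
    exact Set.union_subset (Set.subset_sUnion_of_mem (hT A))
      (Set.subset_sUnion_of_mem (hAB ▸ hT B))
  have hinj : Function.Injective fun A => (⟨c A, hc A⟩ : 𝒞) := fun A B hAB =>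
    (hsub B A (congrArg Subtype.val hAB).symm).antisymm (hsub A B (congrArg Subtype.val hAB))
  have := Nat.card_le_card_of_injective _ hinj
  rw [Nat.card_eq_fintype_card (α := 𝒞), Fintype.card_coe] at this
  have hW : Nat.card (Set W) = 2 ^ Nat.card W := by
    have := Fintype.ofFinite W
    simp
  exact hW ▸ this.trans hcard

theorem eval_le_eval_one_mul_pow (q : Polynomial ℕ) {i n : ℕ} (hq : q.natDegree ≤ i)
    (hn : 1 ≤ n) : q.eval n ≤ q.eval 1 * n ^ i := by
  rw [Polynomial.eval_eq_sum_range, Polynomial.eval_eq_sum_range, Finset.sum_mul]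
  refine Finset.sum_le_sum fun j hj => ?_
  rw [one_pow, mul_one]
  exact Nat.mul_le_mul_left _
    (Nat.pow_le_pow_right hn ((Nat.lt_succ_iff.1 (Finset.mem_range.1 hj)).trans hq))

theorem exists_pow_eval_lt (q : Polynomial ℕ) {i K : ℕ} (hq : q.natDegree ≤ i) (hK : i < K) :
    ∃ n, 4 ≤ n ∧ ∀ w, n ^ K ≤ 2 * w → n ^ q.eval n < 2 ^ w := by
  set c := q.eval 1 with hc
  set s := 4 * c + 1 with hs
  have h4 : 4 ≤ 2 ^ (2 * s) :=
    (by norm_num : 4 ≤ 2 ^ 2).trans (Nat.pow_le_pow_right (by norm_num) (by omega))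
  -- A power of two makes `n ^ q(n)` one as well, so exponents can be compared. Since `s > 4 * c`,
  -- also `n = (2 ^ s) ^ 2 > s ^ 2 > 4 * s * c`, which absorbs the constants.
  refine ⟨2 ^ (2 * s), h4, fun w hw => ?_⟩
  set n := 2 ^ (2 * s) with hn
  rw [show n ^ q.eval n = 2 ^ (2 * s * q.eval n) by rw [hn, ← pow_mul]]
  refine Nat.pow_lt_pow_right (by norm_num) ?_
  have h₁ := eval_le_eval_one_mul_pow q hq (by omega : 1 ≤ n)
  have h₂ : 4 * s * c < n := by
    have hlt : s < 2 ^ s := Nat.lt_two_pow_self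
    have : n = 2 ^ s * 2 ^ s := by rw [hn, two_mul, pow_add]
    nlinarith
  have h₃ : n * n ^ i ≤ n ^ K := by
    rw [← pow_succ']
    exact Nat.pow_le_pow_right (by omega) hK
  have h₄ : 0 < n ^ i := Nat.pow_pos (by omega)
  have h₅ : 4 * s * c * n ^ i < n * n ^ i := Nat.mul_lt_mul_of_pos_right h₂ h₄
  have h₆ : 4 * s * q.eval n ≤ 4 * s * (c * n ^ i) := Nat.mul_le_mul_left _ h₁
  nlinarith

/-- The factor `2` and the bound `4 ≤ Nat.card M` leave room for index sets that omit one or two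
reserved tuples. -/
theorem not_definable_of_isFooling {L : FirstOrder.Language.{v, w}} {D : Finset ℕ} {i K : ℕ}
    (hK : i < K) {P : (M : Type u) → Set (D → M) → Prop}
    (h : ∀ (M : Type u) [Finite M], 4 ≤ Nat.card M → ∃ (W : Type u) (_ : Finite W)
      (T : Set W → Set (D → M)), Nat.card M ^ K ≤ 2 * Nat.card W ∧ IsFooling {T | P M T} T) :
    ¬ Definable (LFU.{u} L i D) P := by
  rintro ⟨φ, hφ, hP⟩
  obtain ⟨q, hq, hcover⟩ := φ.growthBound hφ
  obtain ⟨n, hn, hlt⟩ := exists_pow_eval_lt q hq hK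
  let M : Type u := ULift (Fin n)
  have hM : Nat.card M = n := by simp [M]
  have : Nontrivial M := Finite.one_lt_card_iff_nontrivial.1 (by omega)
  -- The bounds hold for every interpretation of `L`, so any will do.
  let _ : L.Structure M :=
    { funMap := fun _ _ => Classical.arbitrary M
      RelMap := fun _ _ => False }
  obtain ⟨W, _, T, hW, hT⟩ := h M (by omega)
  have hc := hcover M
  simp only [hP] at hc
  rw [hM] at hW hc
  exact (hT.two_pow_le hc).not_gt (hlt _ hW)

theorem card_subtype_ne {α : Type*} [Finite α] (a : α) :
    Nat.card {c : α // c ≠ a} = Nat.card α - 1 := by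
  classical
  have := Fintype.ofFinite α
  simp [Fintype.card_subtype_compl]

/-! ### The particular atoms -/

theorem Distinct₂.exists_assignment {D : Finset ℕ} {k l : ℕ} {x : Fin k → D} {y : Fin l → D}
    (h : Distinct₂ x y) {M : Type*} [Nonempty M] (a : Fin k → M) (b : Fin l → M) :
    ∃ s : D → M, s ∘ x = a ∧ s ∘ y = b := by
  have key := h.extend_apply (Sum.elim a b) (fun _ => Classical.arbitrary M)
  exact ⟨Function.extend _ _ _, funext fun j => key (Sum.inl j), funext fun j => key (Sum.inr j)⟩

theorem Distinct₃.exists_assignment {D : Finset ℕ} {k l m : ℕ} {x : Fin k → D} {y : Fin l → D}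
    {z : Fin m → D} (h : Distinct₃ x y z) {M : Type*} [Nonempty M] (a : Fin k → M)
    (b : Fin l → M) (c : Fin m → M) :
    ∃ s : D → M, s ∘ x = a ∧ s ∘ y = b ∧ s ∘ z = c := by
  have key := h.extend_apply (Sum.elim a (Sum.elim b c)) (fun _ => Classical.arbitrary M)
  exact ⟨Function.extend _ _ _, funext fun j => key (Sum.inl j),
    funext fun j => key (Sum.inr (Sum.inl j)), funext fun j => key (Sum.inr (Sum.inr j))⟩

theorem Distinct₃.swap {D : Finset ℕ} {k l m : ℕ} {x : Fin k → D} {y : Fin l → D}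
    {z : Fin m → D} (h : Distinct₃ x y z) : Distinct₃ y x z := by
  refine Function.Injective.sumElim (fun i j hij => ?_)
    (Function.Injective.sumElim (fun i j hij => ?_) (fun i j hij => ?_) fun i j hij => ?_)
    fun i j hij => ?_
  · simpa using @h (.inr (.inl i)) (.inr (.inl j)) hij
  · simpa using @h (.inl i) (.inl j) hij
  · simpa using @h (.inr (.inr i)) (.inr (.inr j)) hij
  · simpa using @h (.inl i) (.inr (.inr j)) hij
  · rcases j with j | j
    · simpa using @h (.inr (.inl i)) (.inl j) hij
    · simpa using @h (.inr (.inl i)) (.inr (.inr j)) hij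

theorem inclusionAtom_not_definable {L : FirstOrder.Language.{v, w}} {D : Finset ℕ} {k : ℕ}
    {x y : Fin (k + 1) → D} (h : Distinct₂ x y) :
    ¬ Definable (LFU.{u} L k D) (inclusionAtom.{u} x y) := by
  refine not_definable_of_isFooling (Nat.lt_add_one k) fun M _ hM => ?_
  have : Nonempty M := Finite.card_pos_iff.1 (by omega)
  let a : Fin (k + 1) → M := fun _ => Classical.arbitrary M
  -- The reserved value `a` lies in every `E A`. An added assignment with `x`-value `c` and
  -- `y`-value `a` thus belongs to `T B` without being its own witness.
  let E : Set {c // c ≠ a} → Set (Fin (k + 1) → M) := fun A => insert a (Subtype.val '' A)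
  refine ⟨{c // c ≠ a}, inferInstance, fun A => {s | s ∘ x ∈ E A ∧ s ∘ y ∈ E A}, ?_, ?_, ?_⟩
  · have : 4 ≤ Nat.card M ^ (k + 1) := hM.trans (Nat.le_self_pow (by omega) _)
    rw [card_subtype_ne, Nat.card_fun, Nat.card_fin]
    omega
  · intro A s hs
    obtain ⟨s', h₁, h₂⟩ := h.exists_assignment (s ∘ x) (s ∘ x)
    exact ⟨s', ⟨h₁ ▸ hs.1, h₂ ▸ hs.1⟩, h₂.symm⟩
  · intro A B c hcB hcA
    obtain ⟨s, hsx, hsy⟩ := h.exists_assignment c.1 a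
    refine ⟨insert s _, Set.subset_insert _ _, Set.insert_subset (Or.inr ⟨?_, ?_⟩)
      Set.subset_union_left, fun hC => ?_⟩
    · exact hsx ▸ Set.mem_insert_of_mem _ ⟨c, hcB, rfl⟩
    · exact hsy ▸ Set.mem_insert _ _
    · obtain ⟨s', hs', heq⟩ := hC s (Set.mem_insert _ _)
      rw [hsx] at heq
      rcases hs' with rfl | hs'
      · exact c.2 (heq.trans hsy)
      · have hc : c.1 ∈ E A := heq ▸ hs'.2
        rcases hc with hc | ⟨c', hc', hcc⟩
        · exact c.2 hc
        · exact hcA (Subtype.ext hcc ▸ hc')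

theorem anonymityAtom_not_definable {L : FirstOrder.Language.{v, w}} {D : Finset ℕ} {k : ℕ}
    {x : Fin (k + 1) → D} {y : D} (h : Distinct₂ x fun _ : Fin 1 => y) :
    ¬ Definable (LFU.{u} L k D) (anonymityAtom.{u} x y) := by
  refine not_definable_of_isFooling (Nat.lt_add_one k) fun M _ hM => ?_
  have : Nontrivial M := Finite.one_lt_card_iff_nontrivial.1 (by omega)
  refine ⟨Fin (k + 1) → M, inferInstance, fun A => {s | s ∘ x ∈ A}, ?_, ?_, ?_⟩
  · rw [Nat.card_fun, Nat.card_fin]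
    omega
  · intro A s hs
    obtain ⟨b, hb⟩ := exists_ne (s y)
    obtain ⟨s', h₁, h₂⟩ := h.exists_assignment (s ∘ x) (fun _ => b)
    refine ⟨s', (congrArg (· ∈ A) h₁).mpr hs, h₁.symm, ?_⟩
    rw [show s' y = b from congrFun h₂ 0]
    exact hb.symm
  -- An added assignment with `x`-value `c` is alone in its fibre.
  · intro A B c hcB hcA
    obtain ⟨s, hsx, -⟩ := h.exists_assignment c (fun _ => Classical.arbitrary M)
    refine ⟨insert s _, Set.subset_insert _ _, Set.insert_subset (Or.inr
      ((congrArg (· ∈ B) hsx).mpr hcB)) Set.subset_union_left, fun hC => ?_⟩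
    obtain ⟨s', rfl | hs', heq, hne⟩ := hC s (Set.mem_insert _ _)
    · exact hne rfl
    · exact hcA (hsx ▸ heq ▸ hs')

theorem exclusionAtom_not_definable {L : FirstOrder.Language.{v, w}} {D : Finset ℕ} {k : ℕ}
    {x y : Fin (k + 1) → D} (h : Distinct₂ x y) :
    ¬ Definable (LFU.{u} L k D) (exclusionAtom.{u} x y) := by
  refine not_definable_of_isFooling (Nat.lt_add_one k) fun M _ hM => ?_
  have : Nontrivial M := Finite.one_lt_card_iff_nontrivial.1 (by omega)
  obtain ⟨a, b, hab⟩ := exists_pair_ne (Fin (k + 1) → M)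
  let W := {c : {c : Fin (k + 1) → M // c ≠ a} // c ≠ ⟨b, hab.symm⟩}
  -- With `a` in and `b` outside every `E A`, the pair `(c, b)` is available in `T B` and `(a, c)`
  -- in `T A`; together they violate exclusion.
  let E : Set W → Set (Fin (k + 1) → M) := fun A => insert a ((fun c : W => c.1.1) '' A)
  have hE : ∀ (A : Set W) (c : W), c.1.1 ∈ E A → c ∈ A := by
    rintro A c (hc | ⟨c', hc', hcc⟩)
    · exact absurd hc c.1.2
    · exact Subtype.ext (Subtype.ext hcc) ▸ hc'
  have hb : ∀ A, b ∉ E A := by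
    rintro A (hb | ⟨c, -, hc⟩)
    · exact hab hb.symm
    · exact c.2 (Subtype.ext hc)
  refine ⟨W, inferInstance, fun A => {s | s ∘ x ∈ E A ∧ s ∘ y ∉ E A}, ?_, ?_, ?_⟩
  · have : 4 ≤ Nat.card M ^ (k + 1) := hM.trans (Nat.le_self_pow (by omega) _)
    rw [card_subtype_ne, card_subtype_ne, Nat.card_fun, Nat.card_fin]
    omega
  · exact fun A s hs s' hs' heq => hs'.2 (heq ▸ hs.1)
  · intro A B c hcB hcA
    refine ⟨_, Set.subset_union_left, subset_rfl, fun hC => ?_⟩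
    obtain ⟨s, hsx, hsy⟩ := h.exists_assignment c.1.1 b
    obtain ⟨s', hsx', hsy'⟩ := h.exists_assignment a c.1.1
    refine hC s (Or.inr ⟨?_, ?_⟩) s' (Or.inl ⟨?_, ?_⟩) (hsx.trans hsy'.symm)
    · exact hsx ▸ Set.mem_insert_of_mem _ ⟨c, hcB, rfl⟩
    · exact hsy ▸ hb B
    · exact hsx' ▸ Set.mem_insert _ _
    · exact hsy' ▸ fun hc => hcA (hE A c hc)

theorem dependenceAtom_not_definable {L : FirstOrder.Language.{v, w}} {D : Finset ℕ} {k : ℕ}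
    {x : Fin (k + 1) → D} {y : D} (h : Distinct₂ x fun _ : Fin 1 => y) :
    ¬ Definable (LFU.{u} L k D) (dependenceAtom.{u} x y) := by
  classical
  refine not_definable_of_isFooling (Nat.lt_add_one k) fun M _ hM => ?_
  have : Nontrivial M := Finite.one_lt_card_iff_nontrivial.1 (by omega)
  obtain ⟨a, b, hab⟩ := exists_pair_ne M
  -- These teams are graphs of two-valued indicator functions; two of them clash wherever the
  -- functions differ.
  refine ⟨Fin (k + 1) → M, inferInstance,
    fun A => {s | s y = if s ∘ x ∈ A then a else b}, ?_, ?_, ?_⟩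
  · rw [Nat.card_fun, Nat.card_fin]
    omega
  · intro A s hs s' hs' heq
    rw [Set.mem_ofPred_eq] at hs hs'
    rw [hs, hs', heq]
  · intro A B c hcB hcA
    refine ⟨_, Set.subset_union_left, subset_rfl, fun hC => ?_⟩
    obtain ⟨s, hsx, hsy⟩ := h.exists_assignment c (fun _ => b)
    obtain ⟨s', hsx', hsy'⟩ := h.exists_assignment c (fun _ => a)
    replace hsy : s y = b := congrFun hsy 0
    replace hsy' : s' y = a := congrFun hsy' 0
    have hs : s y = s' y := hC s (Or.inl (by simp [hsx, hsy, hcA])) s'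
      (Or.inr (by simp [hsx', hsy', hcB])) (hsx.trans hsx'.symm)
    exact hab (hsy'.symm.trans (hs.symm.trans hsy))

theorem independenceAtom_comm {D : Finset ℕ} {k l m : ℕ} (x : Fin k → D) (y : Fin l → D)
    (z : Fin m → D) : independenceAtom.{u} x y z = independenceAtom y x z := by
  have key : ∀ {k l : ℕ} (x : Fin k → D) (y : Fin l → D) (M : Type u) (T : Set (D → M)),
      independenceAtom x y z M T → independenceAtom y x z M T := by
    intro k l x y M T h s hs s' hs' heq
    obtain ⟨t, ht, h₁, h₂, h₃⟩ := h s' hs' s hs heq.symm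
    exact ⟨t, ht, h₁.trans heq.symm, h₃, h₂⟩
  exact funext fun M => funext fun T => propext ⟨key x y M T, key y x M T⟩

theorem independenceAtom_not_definable_aux {L : FirstOrder.Language.{v, w}} {D : Finset ℕ}
    {k l m i : ℕ} {x : Fin k → D} {y : Fin l → D} {z : Fin m → D} (hk : 1 ≤ k) (hl : 1 ≤ l)
    (h : Distinct₃ x y z) (hi : i < k + m) :
    ¬ Definable (LFU.{u} L i D) (independenceAtom.{u} x y z) := by
  refine not_definable_of_isFooling hi fun M _ hM => ?_
  have : Nontrivial M := Finite.one_lt_card_iff_nontrivial.1 (by omega)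
  have : Nonempty (Fin l) := ⟨⟨0, hl⟩⟩
  let a : Fin k → M := fun _ => Classical.arbitrary M
  let W := {c : Fin k → M // c ≠ a} × (Fin m → M)
  -- Membership ignores `y`, so independence holds. The assignments with `x`-value `a` give every
  -- `z`-fibre all `y`-values, so one added assignment over a pair `(c, e)` outside `A` would need
  -- companions that are missing.
  refine ⟨W, inferInstance,
    fun A => {s | s ∘ x = a ∨ ∃ c ∈ A, s ∘ x = c.1.1 ∧ s ∘ z = c.2}, ?_, ?_, ?_⟩
  · have : 4 ≤ Nat.card M ^ k := hM.trans (Nat.le_self_pow (by omega) _)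
    rw [Nat.card_prod, card_subtype_ne, Nat.card_fun, Nat.card_fun, Nat.card_fin, Nat.card_fin,
      pow_add, ← mul_assoc]
    exact Nat.mul_le_mul_right _ (by omega)
  · intro A s hs s' hs' heq
    obtain ⟨t, htx, hty, htz⟩ := h.exists_assignment (s ∘ x) (s' ∘ y) (s ∘ z)
    refine ⟨t, ?_, htz, htx, hty⟩
    rw [Set.mem_ofPred_eq, htx, htz]
    exact hs
  · rintro A B ⟨c, e⟩ hcB hcA
    obtain ⟨d, d', hdd⟩ := exists_pair_ne (Fin l → M)
    obtain ⟨s, hsx, hsy, hsz⟩ := h.exists_assignment c.1 d e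
    obtain ⟨s', hsx', hsy', hsz'⟩ := h.exists_assignment a d' e
    refine ⟨insert s _, Set.subset_insert _ _, Set.insert_subset
      (Or.inr (Or.inr ⟨_, hcB, hsx, hsz⟩)) Set.subset_union_left, fun hC => ?_⟩
    obtain ⟨t, ht, htz, htx, hty⟩ := hC s (Set.mem_insert _ _) s'
      (Set.mem_insert_of_mem _ (Or.inl hsx')) (hsz.trans hsz'.symm)
    rcases ht with rfl | ht | ⟨c', hc', hx', hz'⟩
    · exact hdd (hsy.symm.trans (hty.trans hsy'))
    · exact c.2 (hsx.symm.trans (htx.symm.trans ht))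
    · have : (c, e) = c' := Prod.ext (Subtype.ext (hsx.symm.trans (htx.symm.trans hx')))
        (hsz.symm.trans (htz.symm.trans hz'))
      exact hcA (this ▸ hc')

theorem independenceAtom_not_definable {L : FirstOrder.Language.{v, w}} {D : Finset ℕ}
    {k l m i : ℕ} {x : Fin k → D} {y : Fin l → D} {z : Fin m → D} (hk : 1 ≤ k) (hl : 1 ≤ l)
    (h : Distinct₃ x y z) (hi : i < max k l + m) :
    ¬ Definable (LFU.{u} L i D) (independenceAtom.{u} x y z) := by
  rcases le_total l k with hlk | hkl
  · exact independenceAtom_not_definable_aux hk hl h (by rwa [max_eq_left hlk] at hi)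
  · rw [independenceAtom_comm]
    exact independenceAtom_not_definable_aux hl hk h.swap (by rwa [max_eq_right hkl] at hi)

theorem Definable.mono {L : FirstOrder.Language.{v, w}} {D : Finset ℕ}
    {Φ Ψ : Set (Formula.{u} L D)} (h : Φ ⊆ Ψ) {P : (M : Type u) → Set (D → M) → Prop}
    (hP : Definable Φ P) : Definable Ψ P := by
  obtain ⟨φ, hφ, hP⟩ := hP
  exact ⟨φ, h hφ, hP⟩

end TeamSem

theorem mainTheorem2 (L : FirstOrder.Language.{v, w}) (D : Finset ℕ) :
    (∀ (k : ℕ) (x y : Fin (k + 1) → D), TeamSem.Distinct₂ x y →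
      ¬ TeamSem.Definable (TeamSem.LEU.{u} L k D) (TeamSem.inclusionAtom x y)) ∧
    (∀ (k : ℕ) (x : Fin (k + 1) → D) (y : D), TeamSem.Distinct₂ x (fun _ : Fin 1 => y) →
      ¬ TeamSem.Definable (TeamSem.LEU.{u} L k D) (TeamSem.anonymityAtom x y)) ∧
    (∀ (k : ℕ) (x y : Fin (k + 1) → D), TeamSem.Distinct₂ x y →
      ¬ TeamSem.Definable (TeamSem.LEU.{u} L k D) (TeamSem.exclusionAtom x y)) ∧
    (∀ (k : ℕ) (x : Fin (k + 1) → D) (y : D), TeamSem.Distinct₂ x (fun _ : Fin 1 => y) →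
      ¬ TeamSem.Definable (TeamSem.LFU.{u} L k D) (TeamSem.dependenceAtom x y)) ∧
    (∀ (k l m i : ℕ) (x : Fin k → D) (y : Fin l → D) (z : Fin m → D), 1 ≤ k → 1 ≤ l →
      TeamSem.Distinct₃ x y z → i < max k l + m →
      ¬ TeamSem.Definable (TeamSem.LFU.{u} L i D) (TeamSem.independenceAtom x y z)) :=
  ⟨fun k _ _ h hd => TeamSem.inclusionAtom_not_definable h (hd.mono (TeamSem.LEU_subset_LFU L k D)),
    fun k _ _ h hd => TeamSem.anonymityAtom_not_definable h
      (hd.mono (TeamSem.LEU_subset_LFU L k D)),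
    fun k _ _ h hd => TeamSem.exclusionAtom_not_definable h
      (hd.mono (TeamSem.LEU_subset_LFU L k D)),
    fun _ _ _ h => TeamSem.dependenceAtom_not_definable h,
    fun _ _ _ _ _ _ _ hk hl h hi => TeamSem.independenceAtom_not_definable hk hl h hi⟩
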